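/- Let $0\le p\le m\le n$ be integers. Consider $n$ agents $x_1,\dots,x_n$ and $m$ observers $y_1,\dots,y_m$. A communication topology is a zero/nonzero pattern $[A]$ of an $n\times n$ matrix, with an edge $(x_i,x_j)$ whenever $[A]_{ji}\neq 0$; every agent is required to have a self loop $(x_i,x_i)$. An observation topology is a pattern $[C]$ of an $m\times n$ matrix, with an edge $(x_j,y_i)$ whenever $[C]_{ij}\ne 0$; each observer observes exactly one agent and no two observers observe the same agent. For a set $F=\{x_{i_1},\dots,x_{i_{p'}}\}$ of compromised agents, $[B^a]$ is the $n\times p'$ pattern whose nonzero entries are exactly those in the positions $(i_l,l)$, $1\le l\le p'$. Nonzero entries of a pattern are free real parameters, all other entries are fixed to $0$. A real system $(A,B,C)$ is left invertible if, for $x(k+1)=Ax(k)+Bu(k)$, $y(k)=Cx(k)$, $x(0)=0$, the condition $y(k)=0$ for all $k\ge0$ implies $u(k)=0$ for all $k\ge 0$. The structural system $([A],[B^a],[C])$ is structurally left invertible if all its realizations, except for a set of parameter values of Lebesgue measure zero, are left invertible. Let $\|A\|_0$ be the number of nonzero entries of $[A]$. Call $([A],[C])$ feasible if it satisfies the above requirements,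 if all communication edges are of the form $(x_i,x_{i+k})$ with $0\le k\le p$ and $i+k\le n$, and if $([A],[B^a],[C])$ is structurally left invertible for every $F\subseteq\{x_1,\dots,x_n\}$ with $|F|\le p$. Then the minimum of $\|A\|_0$ over all feasible pairs $([A],[C])$ is $$\|A\|_0^*=(n-m)p+n .$$ It is attained by the feasible pair with communication edges $$\{(x_i,x_{i+k}) : 1\le i\le n-m,\ 0\le k\le p\}\cup\{(x_i,x_i): n-m+1\le i\le n\}$$ and observation edges $\{(x_{n-m+i},y_i): 1\le i\le m\}$. -/

import Mathlib

open MeasureTheory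

/-- A structural matrix `[M]` with rows `ι` and columns `κ`, given by the finite set of its nonzero
positions: an entry `M i j` with `(i, j) ∈ [M]` is a free real parameter, every other entry is fixed
to be `0`. -/
abbrev StructMatrix (ι κ : Type*) := Finset (ι × κ)

namespace StructMatrix

variable {ι κ : Type*} [DecidableEq ι] [DecidableEq κ]

/-- The number `‖M‖₀` of nonzero entries of a structural matrix. -/
def zeroNorm (M : StructMatrix ι κ) : ℕ := Finset.card M

/-- The numerical realization of `[M]` in which the free parameters take the values `θ`. -/
def realize (M : StructMatrix ι κ) (θ : M → ℝ) : Matrix ι κ ℝ :=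
  fun i j => if h : (i, j) ∈ M then θ ⟨(i, j), h⟩ else 0

end StructMatrix

/-- `(A, B, C, D)` is left invertible: for the system `x(k+1) = A x(k) + B u(k)`,
`y(k) = C x(k) + D u(k)` started at `x(0) = 0`, if `y(k) = 0` for all `k` then `u(k) = 0`
for all `k`. -/
def LeftInvertible {X U Y : Type*} [Fintype X] [Fintype U]
    (A : Matrix X X ℝ) (B : Matrix X U ℝ) (C : Matrix Y X ℝ) (D : Matrix Y U ℝ) : Prop :=
  ∀ (u : ℕ → U → ℝ) (x : ℕ → X → ℝ), x 0 = 0 →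
    (∀ k, x (k + 1) = A.mulVec (x k) + B.mulVec (u k)) →
    (∀ k, C.mulVec (x k) + D.mulVec (u k) = 0) → ∀ k, u k = 0

/-- `([A], [B], [C], [D])` is structurally left invertible: all realizations are left invertible,
except for a set of parameter values of Lebesgue measure zero. -/
def StructurallyLeftInvertible {X U Y : Type*} [Fintype X] [Fintype U]
    [DecidableEq X] [DecidableEq U] [DecidableEq Y]
    (A : StructMatrix X X) (B : StructMatrix X U) (C : StructMatrix Y X)
    (D : StructMatrix Y U) : Prop :=
  ∀ᵐ θ : (A → ℝ) × (B → ℝ) × (C → ℝ) × (D → ℝ) ∂volume,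
    LeftInvertible (A.realize θ.1) (B.realize θ.2.1) (C.realize θ.2.2.1) (D.realize θ.2.2.2)

/-- The structural matrix `[Bᵃ]` of an attack on the set `F` of agents: there is one attack input for
each compromised agent, and it enters the dynamics of exactly that agent. -/
def attackMatrix {n : ℕ} (F : Finset (Fin n)) : StructMatrix (Fin n) F :=
  Finset.univ.filter fun e => e.1 = (e.2 : Fin n)

/-- `(x_i, x_j)` is a communication edge, i.e. `[A]_{ji} ≠ 0`. -/
def CommEdge {n : ℕ} (A : StructMatrix (Fin n) (Fin n)) (i j : Fin n) : Prop := (j, i) ∈ A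

/-- `(x_j, y_i)` is an observation edge, i.e. `[C]_{ij} ≠ 0`. -/
def ObsEdge {n m : ℕ} (C : StructMatrix (Fin m) (Fin n)) (j : Fin n) (i : Fin m) : Prop :=
  (i, j) ∈ C

/-- The feasible pairs `([A], [C])` of the platooning problem with `n` agents, `m` observers and at
most `p` compromised agents (state attacks only, so that `[Dᵃ] = 0`). -/
structure PlatoonFeasible (n m p : ℕ) (A : StructMatrix (Fin n) (Fin n))
    (C : StructMatrix (Fin m) (Fin n)) : Prop where
  /-- every agent has a self loop -/
  self_loop : ∀ i, CommEdge A i i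
  /-- every observer measures exactly one agent -/
  observes_one : ∀ i, ∃! j, ObsEdge C j i
  /-- no two observers measure the same agent -/
  observers_distinct : ∀ i i' j, ObsEdge C j i → ObsEdge C j i' → i = i'
  /-- all communication edges are of the form `(x_i, x_{i+k})` with `0 ≤ k ≤ p` -/
  band : ∀ i j, CommEdge A i j → ∃ k ≤ p, (j : ℕ) = (i : ℕ) + k
  /-- structural left invertibility for all attacks on at most `p` agents -/
  left_invertible : ∀ F : Finset (Fin n), F.card ≤ p →
    StructurallyLeftInvertible A (attackMatrix F) C ∅

/-- The banded topology: each of the first `n - m` agents `x_i` has the edges `(x_i, x_{i+k})`,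
`0 ≤ k ≤ p`, and each of the last `m` agents has only its self loop. An entry `e = (j, i)` stands for
the edge `(x_i, x_j)`; agents are numbered from `0`. -/
def platoonA (n m p : ℕ) : StructMatrix (Fin n) (Fin n) :=
  Finset.univ.filter fun e =>
    ((e.2 : ℕ) < n - m ∧ (e.2 : ℕ) ≤ e.1 ∧ (e.1 : ℕ) ≤ e.2 + p) ∨ e.1 = e.2

/-- The `i`-th observer measures the `i`-th one of the last `m` agents. -/
def platoonC (n m : ℕ) : StructMatrix (Fin m) (Fin n) :=
  Finset.univ.filter fun e => (e.2 : ℕ) = n - m + e.1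

/-! Lower bound: if an unobserved agent has at most `p` out-neighbours, itself included, compromise
all of them. The inputs can then hold the state at the unit vector of that agent, which no observer
sees. So unobserved agents need `p + 1` outgoing edges, observed ones at least their self loop;
exactly `n - m` agents are unobserved.

Attainment: zero output confines the state to the first `n - m` coordinates. For `|F| ≤ p`, the
`i`-th agent outside `F` lies in the band of `i`, so `n - m` attack-free rows meet these columns in
a square block with free diagonal, generically nonsingular. On those rows the dynamics read `S z(k)
= E z(k+1)` with `S` invertible; iterating backwards with `z(0) = 0` forces `z = 0`, hence `u = 0`.
-/

/-! ### Generic nonvanishing of determinants -/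

/-- A continuous function that is nonzero almost everywhere on every line through a fixed point
is nonzero almost everywhere. -/
theorem ae_ne_zero_of_forall_line {E : Type*} [NormedAddCommGroup E] [NormedSpace ℝ E]
    [MeasurableSpace E] [BorelSpace E] [FiniteDimensional ℝ E] (μ : Measure E)
    [μ.IsAddHaarMeasure] {f : E → ℝ} (hf : Continuous f) (x₀ : E)
    (h : ∀ v, ∀ᵐ t : ℝ, f (x₀ + t • v) ≠ 0) : ∀ᵐ x ∂μ, f x ≠ 0 := by
  have hmeas : MeasurableSet {q : E × ℝ | f (x₀ + q.2 • q.1) ≠ 0} := by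
    have hc : Continuous fun q : E × ℝ => f (x₀ + q.2 • q.1) := by fun_prop
    exact (isOpen_ne_fun hc continuous_const).measurableSet
  -- Fubini gives one `t ≠ 0` that works for almost all directions; `v ↦ x₀ + t • v` then only
  -- rescales Haar measure.
  have hswap : ∀ᵐ t : ℝ, ∀ᵐ v ∂μ, f (x₀ + t • v) ≠ 0 :=
    (Measure.ae_ae_comm hmeas).1 (Filter.Eventually.of_forall h)
  obtain ⟨t, ht, ht0⟩ := (hswap.and (Measure.ae_ne volume (0 : ℝ))).exists
  rw [ae_iff] at ht ⊢
  have hpre : {v | ¬ f (x₀ + t • v) ≠ 0}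
      = (t • · : E → E) ⁻¹' ((x₀ + ·) ⁻¹' {x | ¬ f x ≠ 0}) := rfl
  rw [hpre, Measure.addHaar_preimage_smul μ ht0, measure_preimage_add] at ht
  refine (mul_eq_zero.1 ht).resolve_left ?_
  simpa [abs_pos] using pow_pos (abs_pos.2 ht0) _

/-- The determinant does not vanish almost everywhere on a line through the identity matrix. -/
theorem ae_det_one_add_smul_ne_zero {N : Type*} [Fintype N] [DecidableEq N] (M : Matrix N N ℝ) :
    ∀ᵐ t : ℝ, (1 + t • M).det ≠ 0 := by
  set P : Polynomial ℝ := (1 + (Polynomial.X : Polynomial ℝ) • M.map Polynomial.C).det with hP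
  have heval : ∀ t : ℝ, P.eval t = (1 + t • M).det := by
    intro t
    rw [hP, ← Polynomial.coe_evalRingHom, RingHom.map_det]
    congr 1
    ext i j
    by_cases hij : i = j <;> simp [hij] <;> ring
  have hP0 : P ≠ 0 := by
    intro h0
    have := heval 0
    simp [h0] at this
  have hfin : {t : ℝ | P.eval t = 0}.Finite := by
    simpa [Polynomial.IsRoot] using Polynomial.finite_setOfPred_isRoot hP0
  have := hfin.measure_zero (volume : Measure ℝ)
  rw [ae_iff]
  simpa [← heval] using this

namespace StructMatrix

variable {ι κ : Type*} [DecidableEq ι] [DecidableEq κ]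

theorem realize_of_mem {M : StructMatrix ι κ} (θ : M → ℝ) {i : ι} {j : κ} (h : (i, j) ∈ M) :
    M.realize θ i j = θ ⟨(i, j), h⟩ := dif_pos h

theorem realize_of_notMem {M : StructMatrix ι κ} (θ : M → ℝ) {i : ι} {j : κ} (h : (i, j) ∉ M) :
    M.realize θ i j = 0 := dif_neg h

theorem realize_add_smul (M : StructMatrix ι κ) (θ η : M → ℝ) (t : ℝ) :
    M.realize (θ + t • η) = M.realize θ + t • M.realize η := by
  ext i j
  by_cases h : (i, j) ∈ M <;> simp [realize, h]

theorem continuous_realize (M : StructMatrix ι κ) : Continuous (M.realize) := by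
  refine continuous_pi fun i => continuous_pi fun j => ?_
  unfold realize
  split_ifs with h
  · exact continuous_apply _
  · exact continuous_const

theorem ae_ne_zero {ι κ : Type*} (M : StructMatrix ι κ) :
    ∀ᵐ θ : M → ℝ, ∀ e, θ e ≠ 0 :=
  ae_all_iff.2 fun e =>
    (Measure.quasiMeasurePreserving_eval (fun _ : M => (volume : Measure ℝ)) e).ae
      (Measure.ae_ne volume 0)

/-- A square submatrix of a structural matrix whose diagonal positions are free is generically
nonsingular. -/
theorem ae_det_submatrix_ne_zero {N : Type*} [Fintype N] [DecidableEq N] (M : StructMatrix ι κ)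
    {r : N → ι} {c : N → κ} (hr : Function.Injective r) (hc : Function.Injective c)
    (hrc : ∀ i, (r i, c i) ∈ M) :
    ∀ᵐ θ : M → ℝ, ((M.realize θ).submatrix r c).det ≠ 0 := by
  classical
  -- Base point at which the submatrix is the identity; injectivity of `r` and `c` keeps the ones
  -- off its other entries.
  let θ₀ : M → ℝ := fun e => if ∃ i, (r i, c i) = e.1 then 1 else 0
  have hθ₀ : (M.realize θ₀).submatrix r c = 1 := by
    ext i j
    by_cases hij : i = j
    · subst hij
      rw [Matrix.submatrix_apply, realize_of_mem _ (hrc i), Matrix.one_apply_eq]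
      exact if_pos ⟨i, rfl⟩
    · rw [Matrix.submatrix_apply, Matrix.one_apply_ne hij]
      by_cases hm : (r i, c j) ∈ M
      · rw [realize_of_mem _ hm]
        refine if_neg ?_
        rintro ⟨k, hk⟩
        exact hij ((hr (Prod.ext_iff.1 hk).1).symm.trans (hc (Prod.ext_iff.1 hk).2))
      · exact realize_of_notMem _ hm
  refine ae_ne_zero_of_forall_line volume
    ((M.continuous_realize.matrix_submatrix r c).matrix_det) θ₀ fun η => ?_
  filter_upwards [ae_det_one_add_smul_ne_zero ((M.realize η).submatrix r c)] with t ht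
  rw [realize_add_smul]
  rwa [← hθ₀] at ht

end StructMatrix

/-! ### Implicit systems and vanishing of the state -/

/-- A forward orbit of an implicit system `x(k) = G x(k+1)` on a finite-dimensional space that
starts at `0` stays at `0`. -/
theorem LinearMap.eq_zero_of_eq_apply_succ {K V : Type*} [Field K] [AddCommGroup V] [Module K V]
    [FiniteDimensional K V] (G : V →ₗ[K] V) (x : ℕ → V) (h0 : x 0 = 0)
    (h : ∀ k, x k = G (x (k + 1))) (k : ℕ) : x k = 0 := by
  -- Fitting decomposition: for large powers of `G`, kernel and range are complementary. Each `x (k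
  -- + 1)` will lie in both.
  obtain ⟨d, hd⟩ := Filter.eventually_atTop.1 (LinearMap.eventually_isCompl_ker_pow_range_pow G)
  have hpow : ∀ j k, x k = (G ^ j) (x (k + j)) := by
    intro j
    induction j with
    | zero => simp
    | succ j ih =>
      intro k
      rw [ih k, h (k + j), pow_succ]
      rfl
  induction k with
  | zero => exact h0
  | succ k ih =>
    have hker : x (k + 1) ∈ LinearMap.ker (G ^ (d + 1)) := by
      rw [LinearMap.mem_ker, pow_succ, Module.End.mul_apply, ← h k, ih, map_zero]
    have hran : x (k + 1) ∈ LinearMap.range (G ^ (d + 1)) := ⟨_, (hpow (d + 1) (k + 1)).symm⟩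
    exact Submodule.disjoint_def.1 (hd (d + 1) (Nat.le_succ d)).disjoint _ hker hran

/-- If the rows `r` of the system carry no input, the states `c` are the only ones that need not
vanish when the output does, and the submatrix of the dynamics on `r` and `c` is nonsingular, then
zero output forces zero state. -/
theorem state_eq_zero_of_det_submatrix_ne_zero {X N : Type*} [Fintype X] [Fintype N]
    [DecidableEq N] {A : Matrix X X ℝ} {r c : N → X} (hc : Function.Injective c)
    (hdet : (A.submatrix r c).det ≠ 0) (x : ℕ → X → ℝ) (hx0 : x 0 = 0)
    (hsupp : ∀ k j, j ∉ Set.range c → x k j = 0)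
    (hx : ∀ k i, x (k + 1) (r i) = A.mulVec (x k) (r i)) (k : ℕ) : x k = 0 := by
  classical
  -- `E` recovers the coordinates `r` of the state from its coordinates `c`; it may be singular.
  let E : Matrix N N ℝ := Matrix.of fun i j => if c j = r i then 1 else 0
  let z : ℕ → N → ℝ := fun k i => x k (c i)
  have hsum : ∀ (k : ℕ) (w : X → ℝ), ∑ i, w (c i) * x k (c i) = ∑ j, w j * x k j := fun k w =>
    Fintype.sum_of_injective c hc _ (fun j => w j * x k j)
      (fun j hj => by simp [hsupp k j hj]) fun _ => rfl
  have hE : ∀ k, E.mulVec (z k) = fun i => x k (r i) := by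
    intro k
    ext i
    have := hsum k fun j => if j = r i then 1 else 0
    simpa [E, z, Matrix.mulVec, dotProduct] using this
  have hS : ∀ k, (A.submatrix r c).mulVec (z k) = E.mulVec (z (k + 1)) := by
    intro k
    rw [hE]
    ext i
    rw [hx]
    exact hsum k (A (r i))
  have hz : ∀ k, z k = 0 :=
    LinearMap.eq_zero_of_eq_apply_succ (Matrix.toLin' ((A.submatrix r c)⁻¹ * E)) z
      (by ext i; simp [z, hx0]) fun k => by
        rw [Matrix.toLin'_apply, ← Matrix.mulVec_mulVec, ← hS, Matrix.mulVec_mulVec,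
          Matrix.nonsing_inv_mul _ (isUnit_iff_ne_zero.2 hdet), Matrix.one_mulVec]
  ext j
  by_cases hj : j ∈ Set.range c
  · obtain ⟨i, rfl⟩ := hj
    exact congrFun (hz k) i
  · exact hsupp k j hj

namespace StructMatrix

variable {ι κ : Type*} [DecidableEq ι] [DecidableEq κ]

theorem realize_mulVec_of_unique [Fintype κ] {M : StructMatrix ι κ} (θ : M → ℝ) (v : κ → ℝ)
    {i : ι} {j : κ} (h : (i, j) ∈ M) (huniq : ∀ j', (i, j') ∈ M → j' = j) :
    (M.realize θ).mulVec v i = θ ⟨(i, j), h⟩ * v j := by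
  rw [Matrix.mulVec, dotProduct, Finset.sum_eq_single j, realize_of_mem θ h]
  · intro j' _ hj'
    rw [realize_of_notMem θ fun hm => hj' (huniq j' hm), zero_mul]
  · simp

theorem realize_mulVec_of_forall_notMem [Fintype κ] {M : StructMatrix ι κ} (θ : M → ℝ)
    (v : κ → ℝ) {i : ι} (h : ∀ j, (i, j) ∉ M) : (M.realize θ).mulVec v i = 0 :=
  Finset.sum_eq_zero fun j _ => by simp only [realize_of_notMem θ (h j), zero_mul]

end StructMatrix

/-! ### Feasibility of the banded topology -/

theorem mem_attackMatrix {n : ℕ} {F : Finset (Fin n)} {i : Fin n} {j : F} :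
    (i, j) ∈ attackMatrix F ↔ i = j := by
  simp [attackMatrix]

theorem mem_platoonA {n m p : ℕ} {i j : Fin n} :
    (j, i) ∈ platoonA n m p ↔
      ((i : ℕ) < n - m ∧ (i : ℕ) ≤ j ∧ (j : ℕ) ≤ i + p) ∨ j = i := by
  simp [platoonA]

theorem mem_platoonC {n m : ℕ} {i : Fin m} {j : Fin n} :
    (i, j) ∈ platoonC n m ↔ (j : ℕ) = n - m + i := by
  simp [platoonC]

/-- The `i`-th smallest agent outside a set of at most `p` agents is one of the agents
`i, …, i + p`. -/
theorem exists_injective_notMem_le {n N p : ℕ} (F : Finset (Fin n)) (hF : F.card ≤ p)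
    (hN : N + p ≤ n) :
    ∃ r : Fin N → Fin n, Function.Injective r ∧
      ∀ i, r i ∉ F ∧ (i : ℕ) ≤ r i ∧ (r i : ℕ) ≤ i + p := by
  have hcard : Fᶜ.card = n - F.card := by simp [Finset.card_compl]
  let e := Fᶜ.orderEmbOfFin hcard
  have hle : N ≤ n - F.card := by omega
  refine ⟨fun i => e (Fin.castLE hle i), e.injective.comp (Fin.castLE_injective hle), fun i => ?_⟩
  set i' := Fin.castLE hle i with hi'
  have hmem : ∀ k, e k ∉ F := fun k => Finset.mem_compl.1 (Fᶜ.orderEmbOfFin_mem hcard k)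
  -- Below `e i'` lie the `i` earlier agents outside `F`, and otherwise only members of `F`: this
  -- gives both bounds.
  have himg : (Finset.Iio i').image e ⊆ Finset.Iio (e i') := by
    intro a ha
    obtain ⟨k, hk, rfl⟩ := Finset.mem_image.1 ha
    exact Finset.mem_Iio.2 (e.strictMono (Finset.mem_Iio.1 hk))
  have hcover : Finset.Iio (e i') ⊆ (Finset.Iio i').image e ∪ F := by
    intro a ha
    by_cases haF : a ∈ F
    · exact Finset.mem_union_right _ haF
    · have : a ∈ Set.range e := by
        rw [Fᶜ.range_orderEmbOfFin hcard]
        simpa using haF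
      obtain ⟨k, rfl⟩ := this
      exact Finset.mem_union_left _ (Finset.mem_image_of_mem _
        (Finset.mem_Iio.2 (e.lt_iff_lt.1 (Finset.mem_Iio.1 ha))))
  have hci : ((Finset.Iio i').image e).card = i := by
    rw [Finset.card_image_of_injective _ e.injective, Fin.card_Iio]
    rfl
  have h1 := Finset.card_le_card himg
  have h2 := (Finset.card_le_card hcover).trans (Finset.card_union_le _ _)
  rw [hci, Fin.card_Iio] at h1 h2
  exact ⟨hmem i', h1, h2.trans (by omega)⟩

/-- The banded topology is structurally left invertible for attacks on at most `p` agents. -/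
theorem platoon_structurallyLeftInvertible {n m p : ℕ} (hpm : p ≤ m) (hmn : m ≤ n)
    (F : Finset (Fin n)) (hF : F.card ≤ p) :
    StructurallyLeftInvertible (platoonA n m p) (attackMatrix F) (platoonC n m) ∅ := by
  obtain ⟨r, hr, hrF⟩ := exists_injective_notMem_le (N := n - m) F hF (by omega)
  have hc : Function.Injective (Fin.castLE (Nat.sub_le n m)) := Fin.castLE_injective _
  have hA := StructMatrix.ae_det_submatrix_ne_zero (platoonA n m p) hr hc fun i =>
    mem_platoonA.2 (Or.inl ⟨i.2, (hrF i).2⟩)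
  have hB := (attackMatrix F).ae_ne_zero
  have hC := (platoonC n m).ae_ne_zero
  have hA' := (Measure.quasiMeasurePreserving_fst (μ := (volume : Measure (platoonA n m p → ℝ)))
    (ν := (volume : Measure ((attackMatrix F → ℝ) × (platoonC n m → ℝ) ×
      ((∅ : StructMatrix (Fin m) F) → ℝ))))).ae hA
  have hB' := (Measure.quasiMeasurePreserving_snd (μ := (volume : Measure (platoonA n m p → ℝ)))
    (ν := (volume : Measure ((attackMatrix F → ℝ) × (platoonC n m → ℝ) ×
      ((∅ : StructMatrix (Fin m) F) → ℝ))))).ae (Measure.quasiMeasurePreserving_fst.ae hB)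
  have hC' := (Measure.quasiMeasurePreserving_snd (μ := (volume : Measure (platoonA n m p → ℝ)))
    (ν := (volume : Measure ((attackMatrix F → ℝ) × (platoonC n m → ℝ) ×
      ((∅ : StructMatrix (Fin m) F) → ℝ))))).ae
      (Measure.quasiMeasurePreserving_snd.ae (Measure.quasiMeasurePreserving_fst.ae hC))
  unfold StructurallyLeftInvertible
  filter_upwards [hA', hB', hC'] with θ hθA hθB hθC
  intro u x hx0 hx hy
  have hobs : ∀ k j, j ∉ Set.range (Fin.castLE (Nat.sub_le n m)) → x k j = 0 := by
    intro k j hj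
    have hjn : n - m ≤ (j : ℕ) := by
      by_contra! hlt
      exact hj ⟨⟨j, hlt⟩, rfl⟩
    let i : Fin m := ⟨j - (n - m), by omega⟩
    have hij : (i, j) ∈ platoonC n m := mem_platoonC.2 (by simp only [i]; omega)
    have hyi := congrFun (hy k) i
    rw [Pi.add_apply, StructMatrix.realize_mulVec_of_forall_notMem θ.2.2.2 _ (by simp), add_zero,
      StructMatrix.realize_mulVec_of_unique _ _ hij fun j' hj' => Fin.ext <|
        (mem_platoonC.1 hj').trans (mem_platoonC.1 hij).symm] at hyi
    exact (mul_eq_zero.1 hyi).resolve_left (hθC _)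
  have hxz := state_eq_zero_of_det_submatrix_ne_zero hc hθA x hx0 hobs fun k i => by
    rw [hx, Pi.add_apply, StructMatrix.realize_mulVec_of_forall_notMem θ.2.1, add_zero]
    intro j hj
    exact (hrF i).1 (mem_attackMatrix.1 hj ▸ j.2)
  intro k
  ext j
  have hxj := congrFun (hx k) j
  rw [hxz, hxz, Matrix.mulVec_zero, zero_add,
    StructMatrix.realize_mulVec_of_unique _ _ (mem_attackMatrix.2 rfl) fun j' hj' =>
      Subtype.ext (mem_attackMatrix.1 hj').symm] at hxj
  exact (mul_eq_zero.1 hxj.symm).resolve_left (hθB _)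

theorem platoonFeasible_platoon {n m p : ℕ} (hpm : p ≤ m) (hmn : m ≤ n) :
    PlatoonFeasible n m p (platoonA n m p) (platoonC n m) where
  self_loop i := mem_platoonA.2 (Or.inr rfl)
  observes_one i := ⟨⟨n - m + i, by omega⟩, mem_platoonC.2 rfl, fun j hj =>
    Fin.ext (mem_platoonC.1 hj)⟩
  observers_distinct i i' j h h' := Fin.ext <| by
    have h1 := mem_platoonC.1 h
    have h2 := mem_platoonC.1 h'
    omega
  band i j h := by
    obtain ⟨-, h1, h2⟩ | h := mem_platoonA.1 h
    · exact ⟨j - i, by omega, by omega⟩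
    · exact ⟨0, Nat.zero_le p, by rw [h, add_zero]⟩
  left_invertible F hF := platoon_structurallyLeftInvertible hpm hmn F hF

/-! ### Counting edges by their source -/

/-- The agents that receive an edge from agent `i`. -/
def outNeighbors {n : ℕ} (A : StructMatrix (Fin n) (Fin n)) (i : Fin n) : Finset (Fin n) :=
  Finset.univ.filter fun j => (j, i) ∈ A

theorem mem_outNeighbors {n : ℕ} {A : StructMatrix (Fin n) (Fin n)} {i j : Fin n} :
    j ∈ outNeighbors A i ↔ (j, i) ∈ A := by
  simp [outNeighbors]

theorem zeroNorm_eq_sum_card_outNeighbors {n : ℕ} (A : StructMatrix (Fin n) (Fin n)) :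
    A.zeroNorm = ∑ i, (outNeighbors A i).card := by
  rw [StructMatrix.zeroNorm,
    Finset.card_eq_sum_card_fiberwise (f := Prod.snd) (t := Finset.univ) (by simp)]
  refine Finset.sum_congr rfl fun i _ => ?_
  refine Finset.card_bij' (fun e _ => e.1) (fun j _ => (j, i)) ?_ ?_ ?_ ?_
  · rintro ⟨a, b⟩ h
    obtain ⟨hA, hb⟩ := Finset.mem_filter.1 h
    obtain rfl : b = i := hb
    exact mem_outNeighbors.2 hA
  · intro j hj
    exact Finset.mem_filter.2 ⟨mem_outNeighbors.1 hj, rfl⟩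
  · rintro ⟨a, b⟩ h
    obtain ⟨h, rfl⟩ := Finset.mem_filter.1 h
    rfl
  · intro j hj
    rfl

/-- Summing `p + 1` over all but `m` agents and `1` over those `m` agents. -/
theorem sum_ite_mem_card {n m p : ℕ} (S : Finset (Fin n)) (hS : S.card = n - m) :
    ∑ i, (if i ∈ S then p + 1 else 1) = (n - m) * p + n := by
  have : ∀ i, (if i ∈ S then p + 1 else 1) = (if i ∈ S then p else 0) + 1 := by
    intro i
    split_ifs <;> simp
  simp [this, Finset.sum_add_distrib, hS]

theorem zeroNorm_platoonA {n m p : ℕ} (hpm : p ≤ m) (hmn : m ≤ n) :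
    (platoonA n m p).zeroNorm = (n - m) * p + n := by
  have hS : (Finset.univ.filter fun i : Fin n => (i : ℕ) < n - m).card = n - m := by
    rw [Fin.card_filter_val_lt]
    omega
  rw [zeroNorm_eq_sum_card_outNeighbors, ← sum_ite_mem_card _ hS]
  refine Finset.sum_congr rfl fun i _ => ?_
  simp only [Finset.mem_filter_univ]
  split_ifs with hi
  -- The band is not truncated: `i < n - m` and `p ≤ m` give `i + p < n`.
  · have : outNeighbors (platoonA n m p) i = Finset.Icc i ⟨i + p, by omega⟩ := by
      ext j
      rw [mem_outNeighbors, mem_platoonA, Finset.mem_Icc, Fin.le_def, Fin.le_def, Fin.ext_iff]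
      dsimp only
      omega
    rw [this, Fin.card_Icc]
    dsimp only
    omega
  · have : outNeighbors (platoonA n m p) i = {i} := by
      ext j
      rw [mem_outNeighbors, mem_platoonA, Finset.mem_singleton]
      tauto
    rw [this, Finset.card_singleton]

/-! ### Hidden attacks and the lower bound -/

/-- With nonzero parameters the attack acts as an invertible diagonal scaling on the coordinates in
`F`. -/
theorem exists_attackMatrix_mulVec_eq {n : ℕ} {F : Finset (Fin n)} {θ : attackMatrix F → ℝ}
    (hθ : ∀ e, θ e ≠ 0) {w : Fin n → ℝ} (hw : ∀ j ∉ F, w j = 0) :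
    ∃ u : F → ℝ, ((attackMatrix F).realize θ).mulVec u = w := by
  refine ⟨fun j => w j / θ ⟨(j, j), mem_attackMatrix.2 rfl⟩, ?_⟩
  ext j
  by_cases hj : j ∈ F
  · rw [StructMatrix.realize_mulVec_of_unique (j := ⟨j, hj⟩) _ _ (mem_attackMatrix.2 rfl)
      fun j' hj' => Subtype.ext (mem_attackMatrix.1 hj').symm]
    exact mul_div_cancel₀ _ (hθ _)
  · rw [hw j hj]
    refine StructMatrix.realize_mulVec_of_forall_notMem _ _ fun j' hj' => hj ?_
    exact mem_attackMatrix.1 hj' ▸ j'.2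

/-- If an unobserved agent and all agents receiving an edge from it are compromised, the attack can
be hidden from the observers. -/
theorem not_structurallyLeftInvertible_outNeighbors {n m : ℕ} {A : StructMatrix (Fin n) (Fin n)}
    {C : StructMatrix (Fin m) (Fin n)} {i : Fin n} (hi : (i, i) ∈ A) (hobs : ∀ l, (l, i) ∉ C) :
    ¬ StructurallyLeftInvertible A (attackMatrix (outNeighbors A i)) C ∅ := by
  intro h
  unfold StructurallyLeftInvertible at h
  have hB := (attackMatrix (outNeighbors A i)).ae_ne_zero
  have hB' := (Measure.quasiMeasurePreserving_snd (μ := (volume : Measure (A → ℝ)))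
    (ν := (volume : Measure ((attackMatrix (outNeighbors A i) → ℝ) × (C → ℝ) ×
      ((∅ : StructMatrix (Fin m) (outNeighbors A i)) → ℝ))))).ae
      (Measure.quasiMeasurePreserving_fst.ae hB)
  have hopen : (volume : Measure ((attackMatrix (outNeighbors A i) → ℝ) × (C → ℝ) ×
      ((∅ : StructMatrix (Fin m) (outNeighbors A i)) → ℝ))).IsOpenPosMeasure := inferInstance
  have hfin : SFinite (volume : Measure ((attackMatrix (outNeighbors A i) → ℝ) × (C → ℝ) ×
      ((∅ : StructMatrix (Fin m) (outNeighbors A i)) → ℝ))) := inferInstance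
  have : (volume : Measure ((A → ℝ) × (attackMatrix (outNeighbors A i) → ℝ) × (C → ℝ) ×
      ((∅ : StructMatrix (Fin m) (outNeighbors A i)) → ℝ))).IsOpenPosMeasure :=
    @Measure.prod.instIsOpenPosMeasure _ _ _ _ _ volume inferInstance _ volume hopen hfin
  obtain ⟨θ, hθ, hθB⟩ := (h.and hB').exists
  have hiF : i ∈ outNeighbors A i := mem_outNeighbors.2 hi
  -- The hidden trajectory: it jumps to the `i`-th unit vector at time `1` and stays there.
  let x : ℕ → Fin n → ℝ := fun k => if k = 0 then 0 else Pi.single i 1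
  have hx : ∀ k j, j ≠ i → x k j = 0 := by
    intro k j hj
    by_cases hk : k = 0 <;> simp [x, hk, hj]
  -- The correction needed is supported on `i` and column `i` of `A`, that is, on the compromised
  -- agents.
  have hu : ∀ k, ∃ u, ((attackMatrix (outNeighbors A i)).realize θ.2.1).mulVec u =
      x (k + 1) - (A.realize θ.1).mulVec (x k) := by
    refine fun k => exists_attackMatrix_mulVec_eq hθB fun j hj => ?_
    have hji : j ≠ i := fun hji => hj (hji ▸ hiF)
    rw [Pi.sub_apply, hx _ _ hji, zero_sub, neg_eq_zero]
    rw [Matrix.mulVec, dotProduct]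
    refine Finset.sum_eq_zero fun l _ => ?_
    by_cases hl : l = i
    · rw [hl, StructMatrix.realize_of_notMem _ fun hm => hj (mem_outNeighbors.2 hm), zero_mul]
    · rw [hx _ _ hl, mul_zero]
  choose u hu using hu
  have hu0 := hθ u x rfl (fun k => by rw [hu]; abel) (fun k => by
    ext l
    rw [Pi.add_apply, StructMatrix.realize_mulVec_of_forall_notMem θ.2.2.2 _ (by simp), add_zero]
    rw [Matrix.mulVec, dotProduct]
    refine Finset.sum_eq_zero fun j _ => ?_
    by_cases hj : j = i
    · rw [hj, StructMatrix.realize_of_notMem _ (hobs l), zero_mul]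
    · rw [hx _ _ hj, mul_zero]) 0
  have h0 := congrFun (hu 0) i
  rw [hu0] at h0
  simp [x] at h0

theorem PlatoonFeasible.le_card_outNeighbors {n m p : ℕ} {A : StructMatrix (Fin n) (Fin n)}
    {C : StructMatrix (Fin m) (Fin n)} (h : PlatoonFeasible n m p A C) {i : Fin n}
    (hobs : ∀ l, (l, i) ∉ C) : p + 1 ≤ (outNeighbors A i).card := by
  by_contra! hlt
  exact not_structurallyLeftInvertible_outNeighbors (h.self_loop i) hobs
    (h.left_invertible _ (Nat.lt_succ_iff.1 hlt))

theorem PlatoonFeasible.le_zeroNorm {n m p : ℕ} {A : StructMatrix (Fin n) (Fin n)}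
    {C : StructMatrix (Fin m) (Fin n)} (h : PlatoonFeasible n m p A C) :
    (n - m) * p + n ≤ A.zeroNorm := by
  choose f hf hfu using h.observes_one
  have hinj : Function.Injective f := fun l l' hl =>
    h.observers_distinct l l' (f l) (hf l) (hl ▸ hf l')
  have hS : (Finset.univ.image f)ᶜ.card = n - m := by
    rw [Finset.card_compl, Finset.card_image_of_injective _ hinj]
    simp
  rw [zeroNorm_eq_sum_card_outNeighbors, ← sum_ite_mem_card _ hS]
  -- The comparison is column by column, the image of `f` being the observed agents.
  refine Finset.sum_le_sum fun i _ => ?_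
  split_ifs with hi
  · refine h.le_card_outNeighbors fun l hl => Finset.mem_compl.1 hi ?_
    rw [hfu l i hl]
    exact Finset.mem_image_of_mem _ (Finset.mem_univ l)
  · exact Finset.card_pos.2 ⟨i, mem_outNeighbors.2 (h.self_loop i)⟩

theorem mainTheorem7 (n m p : ℕ) (hpm : p ≤ m) (hmn : m ≤ n) :
    IsLeast {c : ℕ | ∃ (A : StructMatrix (Fin n) (Fin n)) (C : StructMatrix (Fin m) (Fin n)),
        PlatoonFeasible n m p A C ∧ A.zeroNorm = c} ((n - m) * p + n) ∧
      PlatoonFeasible n m p (platoonA n m p) (platoonC n m) ∧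
      (platoonA n m p).zeroNorm = (n - m) * p + n := by
  have hfeas := platoonFeasible_platoon hpm hmn
  have hnorm := zeroNorm_platoonA hpm hmn
  refine ⟨⟨⟨_, _, hfeas, hnorm⟩, ?_⟩, hfeas, hnorm⟩
  rintro c ⟨A, C, hAC, rfl⟩
  exact hAC.le_zeroNorm
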